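/- Let $K$ be a field. All algebras are associative unital $K$-algebras, modules are left modules. For $f:\mathbb N\to\mathbb N\cup\{\infty\}$ put $\gamma(f)=\inf\{r\in\mathbb R_{\ge 0}: f(i)\le i^r \text{ for all } i\gg 0\}\in[0,\infty]$. Let $R$ be a finitely generated algebra with finite generating set $a_1,\dots,a_s$, let $R_0=K$, $R_1=K+\sum_k Ka_k$, $R_i=R_1^i$, and let $M$ be a finitely generated $R$-module with a finite dimensional generating subspace $M_0$ (i.e. $M=RM_0$); put $M_i=R_iM_0$ (the linear span of the products). Define $$\mathrm{GK}(R)=\gamma(i\mapsto\dim_K R_i),\qquad \mathrm{GK}(M)=\gamma(i\mapsto \dim_K M_i),\qquad \mathrm{fdim}({}_RM)=\gamma(\nu),$$ where $\nu(i)$ is the least $j\in\mathbb N\cup\{\infty\}$ such that $R_jN\supseteq M_0$ for every subspace $N\subseteq M_i$ with $RN=M$ (where $R_\infty:=R$). None of these depends on the choice of $a_1,\dots,a_s$ and $M_0$. The filter dimension $\mathrm{fdim}(R)$ of the algebra $R$ is the filter dimension of the $R\otimes_K R^{op}$-module $R$, where $(a\otimes b)x=axb$. The holonomic number of $R$ is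 $h_R=\inf\{\mathrm{GK}(M): M\ne 0 \text{ a finitely generated } R\text{-module}\}$. Let $A$ be a simple finitely generated algebra and let $B$ be an algebra Morita equivalent to $A$ (that is, the categories of $A$-modules and of $B$-modules are equivalent as $K$-linear categories). Then $B$ is finitely generated, and for every nonzero finitely generated $B$-module $M$ $$\mathrm{GK}(M)\ \ge\ h_A\ \ge\ \frac{\mathrm{GK}(A)}{\mathrm{fdim}(A)+\max\{\mathrm{fdim}(A),1\}},$$ where the quotient is read as $0$ if $\mathrm{fdim}(A)=\infty$. -/

import Mathlib

open Filter
open scoped ENNReal NNReal TensorProduct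

universe u v w

noncomputable section

namespace FilterDim

/-- The degree `γ(f) = inf {r | f(i) ≤ i ^ r for i ≫ 0}` of `f : ℕ → ℕ ∪ {∞}`, a non-negative real
number or `∞` (the infimum of the empty set). -/
def degree (f : ℕ → ℕ∞) : ℝ≥0∞ :=
  ⨅ (r : ℝ≥0) (_ : ∀ᶠ i : ℕ in atTop, (f i : ℝ≥0∞) ≤ (i : ℝ≥0∞) ^ (r : ℝ)), (r : ℝ≥0∞)

theorem degree_le_of_le {f g : ℕ → ℕ∞} {c : ℕ} (hc : 1 ≤ c)
    (h : ∀ i, f i ≤ c * g (c * i + c) + c) : degree f ≤ degree g := by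
  refine le_iInf₂ fun r hr => ?_
  refine ENNReal.le_of_forall_pos_le_add fun ε hε _ => ?_
  rw [← ENNReal.coe_add]
  refine iInf₂_le (r + ε) ?_
  have hT : Tendsto (fun i : ℕ => c * i + c) atTop atTop :=
    tendsto_atTop_mono (fun i => (Nat.le_mul_of_pos_left i hc).trans (Nat.le_add_right _ _)) tendsto_id
  have hlim : Tendsto (fun i : ℕ => ((i : ℝ) ^ (ε : ℝ))) atTop atTop :=
    (tendsto_rpow_atTop (by exact_mod_cast hε)).comp tendsto_natCast_atTop_atTop
  filter_upwards [hT.eventually hr, eventually_ge_atTop 1,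
    hlim.eventually_ge_atTop (c * (2 * c : ℝ) ^ (r : ℝ) + c)] with i h1 h2 h3
  have hi : (1 : ℝ) ≤ i := by exact_mod_cast h2
  have hc' : (1 : ℝ) ≤ c := by exact_mod_cast hc
  have e1 : ((f i : ℕ∞) : ℝ≥0∞) ≤ c * ((c * i + c : ℕ) : ℝ≥0∞) ^ (r : ℝ) + c := by
    calc ((f i : ℕ∞) : ℝ≥0∞) ≤ ((c * g (c * i + c) + c : ℕ∞) : ℝ≥0∞) := by
          exact_mod_cast h i
      _ = c * (g (c * i + c) : ℝ≥0∞) + c := by push_cast; rfl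
      _ ≤ _ := by gcongr
  refine e1.trans ?_
  have e2 : (c * ((c * i + c : ℕ) : ℝ) ^ (r : ℝ) + c) ≤ (i : ℝ) ^ ((r : ℝ) + ε) := by
    rw [Real.rpow_add (by linarith)]
    have k1 : ((c * i + c : ℕ) : ℝ) ^ (r : ℝ) ≤ (2 * c : ℝ) ^ (r : ℝ) * (i : ℝ) ^ (r : ℝ) := by
      rw [← Real.mul_rpow (by positivity) (by positivity)]
      refine Real.rpow_le_rpow (by positivity) ?_ r.2
      push_cast
      nlinarith
    have k2 : (1 : ℝ) ≤ (i : ℝ) ^ (r : ℝ) := Real.one_le_rpow hi r.2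
    calc (c * ((c * i + c : ℕ) : ℝ) ^ (r : ℝ) + c)
        ≤ c * ((2 * c : ℝ) ^ (r : ℝ) * (i : ℝ) ^ (r : ℝ)) + c * (i : ℝ) ^ (r : ℝ) := by
          gcongr
          nlinarith
      _ = (i : ℝ) ^ (r : ℝ) * (c * (2 * c : ℝ) ^ (r : ℝ) + c) := by ring
      _ ≤ _ := by gcongr
  have e3 := ENNReal.ofReal_le_ofReal e2
  rw [ENNReal.ofReal_add (by positivity) (by positivity), ENNReal.ofReal_mul (by positivity),
    ← ENNReal.ofReal_rpow_of_nonneg (by positivity) (NNReal.coe_nonneg r),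
    ← ENNReal.ofReal_rpow_of_pos (by linarith)] at e3
  simpa only [ENNReal.ofReal_natCast, NNReal.coe_add] using e3

section Filtration

variable (K : Type u) [Field K] {A : Type v} [Ring A] [Algebra K A]

/-- The finite set `s` generates the `K`-algebra `A`. -/
def Generates (s : Finset A) : Prop :=
  Algebra.adjoin K (s : Set A) = ⊤

/-- The standard filtration `A_i = A_1 ^ i`, `A_1 = K + ∑_{a ∈ s} K a` (so `A_0 = K`), of `A`
associated with the finite set `s` of generators. -/
def algFilt (s : Finset A) (i : ℕ) : Submodule K A :=
  (1 ⊔ Submodule.span K (s : Set A)) ^ i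

variable {M : Type w} [AddCommGroup M] [Module K M] [Module A M] [IsScalarTower K A M]

variable (A) in
/-- The `K`-subspace `N` generates the `A`-module `M`, that is, `A N = M`. -/
def GeneratesModule (N : Submodule K M) : Prop :=
  Submodule.span A (N : Set M) = ⊤

/-- The standard filtration `M_i = A_i M_0` of an `A`-module `M`, where `A_i M_0` is the `K`-span
of the products `a • m` with `a ∈ A_i` and `m ∈ M_0`. -/
def modFilt (s : Finset A) (M₀ : Submodule K M) (i : ℕ) : Submodule K M :=
  algFilt K s i • M₀

/-- The return function of the `A`-module `M` associated with the generators `s` of `A` and the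
generating subspace `M₀` of `M`: the least `j ∈ ℕ ∪ {∞}` such that `A_j N ⊇ M₀` for all
`K`-subspaces `N ⊆ M_i` that generate the `A`-module `M`. -/
def returnFun (s : Finset A) (M₀ : Submodule K M) (i : ℕ) : ℕ∞ :=
  ⨅ (j : ℕ) (_ : ∀ N : Submodule K M, N ≤ modFilt K s M₀ i → GeneratesModule K A N →
    M₀ ≤ algFilt K s j • N), (j : ℕ∞)

variable {K}

theorem algFilt_mono (s : Finset A) : Monotone (algFilt K s) := fun _ _ h =>
  pow_le_pow_right' le_sup_left h

theorem one_le_algFilt (s : Finset A) (i : ℕ) : (1 : Submodule K A) ≤ algFilt K s i := by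
  have := algFilt_mono (K := K) s (Nat.zero_le i)
  simpa [algFilt] using this

theorem exists_mem_algFilt {s : Finset A} (hs : Generates K s) (x : A) :
    ∃ i, x ∈ algFilt K s i := by
  have hx : x ∈ Algebra.adjoin K (s : Set A) := hs ▸ Algebra.mem_top
  induction hx using Algebra.adjoin_induction with
  | mem x hx =>
    refine ⟨1, ?_⟩
    rw [algFilt, pow_one]
    exact Submodule.mem_sup_right (Submodule.subset_span hx)
  | algebraMap r => exact ⟨0, by rw [algFilt, pow_zero]; exact Submodule.algebraMap_mem r⟩
  | add x y _ _ h₁ h₂ =>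
    obtain ⟨i, hi⟩ := h₁
    obtain ⟨j, hj⟩ := h₂
    exact ⟨max i j, add_mem (algFilt_mono s (le_max_left _ _) hi)
      (algFilt_mono s (le_max_right _ _) hj)⟩
  | mul x y _ _ h₁ h₂ =>
    obtain ⟨i, hi⟩ := h₁
    obtain ⟨j, hj⟩ := h₂
    exact ⟨i + j, by rw [algFilt, pow_add]; exact Submodule.mul_mem_mul hi hj⟩

theorem exists_algFilt_le (s : Finset A) {t : Finset A} (ht : Generates K t) :
    ∃ c, ∀ i, algFilt K s i ≤ algFilt K t (c * i) := by
  choose n hn using exists_mem_algFilt ht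
  refine ⟨s.sup n, fun i => ?_⟩
  rw [algFilt, algFilt, pow_mul]
  refine pow_le_pow_left' (sup_le (one_le_algFilt t _) ?_) i
  rw [Submodule.span_le]
  exact fun a ha => algFilt_mono t (Finset.le_sup (f := n) ha) (hn a)

theorem fg_one : (1 : Submodule K A).FG := by
  rw [Submodule.one_eq_span]
  exact Submodule.fg_span_singleton 1

theorem algFilt_fg (s : Finset A) (i : ℕ) : (algFilt K s i).FG :=
  Submodule.FG.pow (Submodule.FG.sup fg_one ⟨s, rfl⟩) i

theorem modFilt_fg (s : Finset A) {M₀ : Submodule K M} (h : M₀.FG) (i : ℕ) :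
    (modFilt K s M₀ i).FG := by
  classical
  obtain ⟨u, hu⟩ := algFilt_fg (K := K) s i
  obtain ⟨v, rfl⟩ := h
  rw [modFilt, ← hu]
  refine ⟨Finset.image₂ (· • ·) u v, le_antisymm ?_ ?_⟩
  · rw [Submodule.span_le]
    intro x hx
    obtain ⟨a, ha, b, hb, rfl⟩ := Finset.mem_image₂.1 (Finset.mem_coe.1 hx)
    exact Submodule.smul_mem_smul (Submodule.subset_span ha) (Submodule.subset_span hb)
  · rw [Submodule.smul_le]
    intro a ha m hm
    induction ha using Submodule.span_induction with
    | mem a ha =>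
      induction hm using Submodule.span_induction with
      | mem m hm => exact Submodule.subset_span (Finset.mem_coe.2 (Finset.mem_image₂_of_mem ha hm))
      | zero => rw [smul_zero]; exact zero_mem _
      | add x y _ _ hx hy => rw [smul_add]; exact add_mem hx hy
      | smul r x _ hx =>
        rw [← algebraMap_smul A r x, ← mul_smul, ← Algebra.commutes, mul_smul, algebraMap_smul]
        exact Submodule.smul_mem _ _ hx
    | zero => rw [zero_smul]; exact zero_mem _
    | add x y _ _ hx hy => rw [add_smul]; exact add_mem hx hy
    | smul r x _ hx => rw [smul_assoc]; exact Submodule.smul_mem _ _ hx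

theorem algFilt_smul_smul (s : Finset A) (i j : ℕ) (N : Submodule K M) :
    algFilt K s i • algFilt K s j • N = algFilt K s (i + j) • N := by
  rw [← Submodule.smul_assoc, smul_eq_mul, algFilt, algFilt, algFilt, ← pow_add]

theorem exists_mem_modFilt {s : Finset A} (hs : Generates K s) {M₀ : Submodule K M}
    (h₀ : GeneratesModule K A M₀) (x : M) : ∃ i, x ∈ modFilt K s M₀ i := by
  have hx : x ∈ Submodule.span A (M₀ : Set M) := by rw [h₀]; trivial
  induction hx using Submodule.span_induction with
  | mem x hx =>
    refine ⟨0, ?_⟩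
    rw [modFilt, algFilt, pow_zero, Submodule.one_smul]
    exact hx
  | zero => exact ⟨0, zero_mem _⟩
  | add x y _ _ h₁ h₂ =>
    obtain ⟨i, hi⟩ := h₁
    obtain ⟨j, hj⟩ := h₂
    exact ⟨max i j, add_mem (Submodule.smul_mono_left (algFilt_mono s (le_max_left _ _)) hi)
      (Submodule.smul_mono_left (algFilt_mono s (le_max_right _ _)) hj)⟩
  | smul a x _ h₁ =>
    obtain ⟨i, hi⟩ := h₁
    obtain ⟨j, hj⟩ := exists_mem_algFilt hs a
    refine ⟨j + i, ?_⟩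
    rw [modFilt, ← algFilt_smul_smul]
    exact Submodule.smul_mem_smul hj hi

theorem exists_le_modFilt {s : Finset A} (hs : Generates K s) {M₀ : Submodule K M}
    (h₀ : GeneratesModule K A M₀) {N : Submodule K M} (hN : N.FG) :
    ∃ d, N ≤ modFilt K s M₀ d := by
  choose n hn using exists_mem_modFilt hs h₀
  obtain ⟨t, rfl⟩ := hN
  refine ⟨t.sup n, Submodule.span_le.2 fun x hx => ?_⟩
  exact Submodule.smul_mono_left (algFilt_mono s (Finset.le_sup (f := n) hx)) (hn x)

/-- Two standard filtrations of a module are comparable. -/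
theorem exists_modFilt_le (s : Finset A) {t : Finset A} (ht : Generates K t)
    {M₀ N₀ : Submodule K M} (hM : M₀.FG) (hN : GeneratesModule K A N₀) :
    ∃ c, 1 ≤ c ∧ M₀ ≤ modFilt K t N₀ c ∧ (∀ i, algFilt K s i ≤ algFilt K t (c * i)) ∧
      ∀ i, modFilt K s M₀ i ≤ modFilt K t N₀ (c * i + c) := by
  obtain ⟨c, hc⟩ := exists_algFilt_le (K := K) s ht
  obtain ⟨d, hd⟩ := exists_le_modFilt ht hN hM
  have h1 : ∀ i, algFilt K s i ≤ algFilt K t ((c + d + 1) * i) := fun i =>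
    (hc i).trans (algFilt_mono t (Nat.mul_le_mul_right i (by omega)))
  have h2 : M₀ ≤ modFilt K t N₀ (c + d + 1) :=
    hd.trans (Submodule.smul_mono_left (algFilt_mono t (by omega)))
  refine ⟨c + d + 1, by omega, h2, h1, fun i => ?_⟩
  rw [modFilt, modFilt, ← algFilt_smul_smul]
  exact Submodule.smul_mono (h1 i) h2

theorem degree_finrank_le (s : Finset A) {t : Finset A} (ht : Generates K t)
    {M₀ N₀ : Submodule K M} (hM : M₀.FG) (hN₀ : N₀.FG) (hN : GeneratesModule K A N₀) :
    degree (fun i => (Module.finrank K (modFilt K s M₀ i) : ℕ∞)) ≤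
      degree fun i => (Module.finrank K (modFilt K t N₀ i) : ℕ∞) := by
  obtain ⟨c, hc, -, -, h⟩ := exists_modFilt_le s ht hM hN
  refine degree_le_of_le hc fun i => ?_
  have : Module.Finite K (modFilt K t N₀ (c * i + c)) :=
    Module.Finite.iff_fg.2 (modFilt_fg t hN₀ _)
  have h1 := Submodule.finrank_mono (h i)
  norm_cast
  nlinarith

theorem returnFun_spec (s : Finset A) (M₀ : Submodule K M) (i j : ℕ)
    (h : returnFun K s M₀ i = j) (N : Submodule K M) (hN : N ≤ modFilt K s M₀ i)
    (hg : GeneratesModule K A N) : M₀ ≤ algFilt K s j • N := by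
  have h1 : returnFun K s M₀ i < (j + 1 : ℕ) := by rw [h]; exact_mod_cast Nat.lt_succ_self j
  rw [returnFun] at h1
  obtain ⟨k, hk⟩ := iInf_lt_iff.1 h1
  obtain ⟨hk1, hk2⟩ := iInf_lt_iff.1 hk
  have : k ≤ j := by have : k < j + 1 := (by exact_mod_cast hk2); omega
  exact (hk1 N hN hg).trans (Submodule.smul_mono_left (algFilt_mono s this))

theorem degree_returnFun_le {s t : Finset A} (hs : Generates K s) (ht : Generates K t)
    {M₀ N₀ : Submodule K M} (hM₀ : M₀.FG) (hM : GeneratesModule K A M₀)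
    (hN₀ : N₀.FG) (hN : GeneratesModule K A N₀) :
    degree (returnFun K s M₀) ≤ degree (returnFun K t N₀) := by
  obtain ⟨c, hc, c1, c2, c3⟩ := exists_modFilt_le s ht hM₀ hN
  obtain ⟨d, hd, d1, d2, d3⟩ := exists_modFilt_le t hs hN₀ hM
  refine degree_le_of_le (c := c + d * c + d) (by omega) fun i => ?_
  generalize hj : returnFun K t N₀ ((c + d * c + d) * i + (c + d * c + d)) = j
  induction j using ENat.recTopCoe with
  | top =>
    rw [ENat.mul_top (by exact_mod_cast (by omega : c + d * c + d ≠ 0)), top_add]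
    exact le_top
  | coe j =>
    have key := returnFun_spec t N₀ _ j hj
    refine (iInf₂_le (d * (c + j)) fun N h1 h2 => ?_).trans ?_
    · have h3 : N ≤ modFilt K t N₀ ((c + d * c + d) * i + (c + d * c + d)) :=
        (h1.trans (c3 i)).trans (Submodule.smul_mono_left (algFilt_mono t (by
          have : (c + d * c + d) * i = c * i + (d * c + d) * i := by ring
          have := Nat.zero_le ((d * c + d) * i)
          have := Nat.zero_le (d * c)
          omega)))
      calc M₀ ≤ algFilt K t c • N₀ := c1
        _ ≤ algFilt K t c • algFilt K t j • N := Submodule.smul_mono le_rfl (key N h3 h2)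
        _ = algFilt K t (c + j) • N := algFilt_smul_smul _ _ _ _
        _ ≤ _ := Submodule.smul_mono_left (d2 _)
    · norm_cast
      have h4 : (c + d * c + d) * j = (c + d * c) * j + d * j := by ring
      have h5 : d * (c + j) = d * c + d * j := by ring
      have := Nat.zero_le ((c + d * c) * j)
      omega

end Filtration

section Dimensions

variable (K : Type u) [Field K] (A : Type v) [Ring A] [Algebra K A]

/-- The Gelfand-Kirillov dimension of a finitely generated `K`-algebra, the degree of
`i ↦ dim_K A_i`. It does not depend on the generators (`gkDimAlg_eq`), so that the infimum over
them only selects the common value. -/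
def gkDimAlg : ℝ≥0∞ :=
  ⨅ (s : Finset A) (_ : Generates K s),
    degree fun i => (Module.finrank K (algFilt K s i) : ℕ∞)

/-- The Gelfand-Kirillov dimension of a finitely generated module `M` over a finitely generated
`K`-algebra `A`, the degree of `i ↦ dim_K M_i`. It does not depend on the generators of `A` nor on
the finite dimensional generating subspace `M₀` of `M` (`gkDim_eq`). -/
def gkDim (M : Type w) [AddCommGroup M] [Module K M] [Module A M] [IsScalarTower K A M] : ℝ≥0∞ :=
  ⨅ (s : Finset A) (_ : Generates K s) (M₀ : Submodule K M) (_ : M₀.FG)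
    (_ : GeneratesModule K A M₀),
    degree fun i => (Module.finrank K (modFilt K s M₀ i) : ℕ∞)

/-- The filter dimension of a finitely generated module `M` over a finitely generated `K`-algebra
`A`, the degree of the return function. It does not depend on the generators of `A` nor on the
finite dimensional generating subspace `M₀` of `M` (`fdimMod_eq`). -/
def fdimMod (M : Type w) [AddCommGroup M] [Module K M] [Module A M] [IsScalarTower K A M] :
    ℝ≥0∞ :=
  ⨅ (s : Finset A) (_ : Generates K s) (M₀ : Submodule K M) (_ : M₀.FG)
    (_ : GeneratesModule K A M₀), degree (returnFun K s M₀)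

/-- The filter dimension of a finitely generated `K`-algebra `A`: the filter dimension of the
`A`-bimodule `A`, that is, of `A` as a module over `A ⊗[K] Aᵐᵒᵖ`, where
`(a ⊗ b) • x = a * x * b`. -/
def fdim : ℝ≥0∞ :=
  letI : Module (A ⊗[K] Aᵐᵒᵖ) A := instModuleTensorProductMop K A
  haveI : IsScalarTower K (A ⊗[K] Aᵐᵒᵖ) A :=
    ⟨fun r x a => by
      change TensorProduct.Algebra.moduleAux _ _ = _ • TensorProduct.Algebra.moduleAux _ _
      simp⟩
  fdimMod K (A ⊗[K] Aᵐᵒᵖ) A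

/-- The holonomic number `h_A`, the infimum of `GK(M)` over the nonzero finitely generated
`A`-modules `M`. Each of them is isomorphic to a quotient of some `A ^ n`, so it is enough to let
`M` range over the universe of `A`. -/
def holonomicNumber : ℝ≥0∞ :=
  ⨅ (M : Type v) (_ : AddCommGroup M) (_ : Module K M) (_ : Module A M)
    (_ : IsScalarTower K A M) (_ : Module.Finite A M) (_ : Nontrivial M), gkDim K A M

/-- `gkDim` is the degree of `i ↦ dim_K M_i` for every choice of generators. -/
theorem gkDim_eq {K : Type u} [Field K] {A : Type v} [Ring A] [Algebra K A] {M : Type w}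
    [AddCommGroup M] [Module K M] [Module A M] [IsScalarTower K A M] {s : Finset A}
    (hs : Generates K s) {M₀ : Submodule K M} (h₀ : M₀.FG) (h : GeneratesModule K A M₀) :
    gkDim K A M = degree fun i => (Module.finrank K (modFilt K s M₀ i) : ℕ∞) :=
  le_antisymm ((iInf₂_le s hs).trans ((iInf₂_le M₀ h₀).trans (iInf_le _ h)))
    (le_iInf₂ fun _ ht => le_iInf₂ fun _ h₁ => le_iInf fun h₂ => degree_finrank_le s ht h₀ h₁ h₂)

/-- `fdimMod` is the degree of the return function for every choice of generators. -/
theorem fdimMod_eq {K : Type u} [Field K] {A : Type v} [Ring A] [Algebra K A] {M : Type w}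
    [AddCommGroup M] [Module K M] [Module A M] [IsScalarTower K A M] {s : Finset A}
    (hs : Generates K s) {M₀ : Submodule K M} (h₀ : M₀.FG) (h : GeneratesModule K A M₀) :
    fdimMod K A M = degree (returnFun K s M₀) :=
  le_antisymm ((iInf₂_le s hs).trans ((iInf₂_le M₀ h₀).trans (iInf_le _ h)))
    (le_iInf₂ fun _ ht => le_iInf₂ fun _ h₁ => le_iInf fun h₂ =>
      degree_returnFun_le hs ht h₀ h h₁ h₂)

/-- `gkDimAlg` is the degree of `i ↦ dim_K A_i` for every choice of generators. -/
theorem gkDimAlg_eq {K : Type u} [Field K] {A : Type v} [Ring A] [Algebra K A] {s : Finset A}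
    (hs : Generates K s) :
    gkDimAlg K A = degree fun i => (Module.finrank K (algFilt K s i) : ℕ∞) := by
  have key : ∀ (t : Finset A) (i : ℕ), modFilt K t (1 : Submodule K A) i = algFilt K t i :=
    fun t i => mul_one (algFilt K t i)
  refine le_antisymm (iInf₂_le s hs) (le_iInf₂ fun t ht => ?_)
  have hg : GeneratesModule K A (1 : Submodule K A) :=
    (Ideal.eq_top_iff_one _).2 (Submodule.subset_span (Submodule.one_le.1 le_rfl))
  have := degree_finrank_le s ht (M₀ := (1 : Submodule K A)) (N₀ := 1)
    fg_one fg_one hg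
  rwa [funext fun i => congrArg (fun V : Submodule K A => (Module.finrank K V : ℕ∞)) (key s i),
    funext fun i => congrArg (fun V : Submodule K A => (Module.finrank K V : ℕ∞)) (key t i)] at this

/-- The enveloping algebra of a finitely generated algebra is finitely generated. -/
theorem finiteType_tensor_mop (K : Type u) [Field K] (A : Type v) [Ring A] [Algebra K A]
    [hA : Algebra.FiniteType K A] : Algebra.FiniteType K (A ⊗[K] Aᵐᵒᵖ) := by
  classical
  obtain ⟨s, hs⟩ := hA.out
  let l : A →ₐ[K] A ⊗[K] Aᵐᵒᵖ := Algebra.TensorProduct.includeLeft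
  let r : Aᵐᵒᵖ →ₐ[K] A ⊗[K] Aᵐᵒᵖ := Algebra.TensorProduct.includeRight
  refine ⟨s.image l ∪ s.image (fun a => r (MulOpposite.op a)), ?_⟩
  set S := Algebra.adjoin K
    ((s.image l ∪ s.image (fun a => r (MulOpposite.op a)) : Finset _) : Set (A ⊗[K] Aᵐᵒᵖ)) with hS
  have hl : ∀ a, l a ∈ S := fun a => by
    have ha : a ∈ Algebra.adjoin K (s : Set A) := hs ▸ Algebra.mem_top
    induction ha using Algebra.adjoin_induction with
    | mem x hx => exact Algebra.subset_adjoin (by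
        simp only [Finset.coe_union, Finset.coe_image]; exact Or.inl ⟨x, hx, rfl⟩)
    | algebraMap k => rw [AlgHom.commutes]; exact S.algebraMap_mem k
    | add x y _ _ hx hy => rw [map_add]; exact add_mem hx hy
    | mul x y _ _ hx hy => rw [map_mul]; exact mul_mem hx hy
  have hr : ∀ a, r (MulOpposite.op a) ∈ S := fun a => by
    have ha : a ∈ Algebra.adjoin K (s : Set A) := hs ▸ Algebra.mem_top
    induction ha using Algebra.adjoin_induction with
    | mem x hx => exact Algebra.subset_adjoin (by
        simp only [Finset.coe_union, Finset.coe_image]; exact Or.inr ⟨x, hx, rfl⟩)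
    | algebraMap k =>
      rw [← MulOpposite.algebraMap_apply, AlgHom.commutes]; exact S.algebraMap_mem k
    | add x y _ _ hx hy => rw [MulOpposite.op_add, map_add]; exact add_mem hx hy
    | mul x y _ _ hx hy => rw [MulOpposite.op_mul, map_mul]; exact mul_mem hy hx
  rw [eq_top_iff, ← Algebra.TensorProduct.adjoin_tmul_eq_top, Algebra.adjoin_le_iff]
  rintro _ ⟨a, b, rfl⟩
  have : a ⊗ₜ[K] b = l a * r b := by simp [l, r]
  rw [this]
  exact mul_mem (hl a) (hr b.unop)

end Dimensions

end FilterDim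

end

/-!
The lower bound for the holonomic number rests on one observation about a simple algebra `A` and a
nonzero module `M = A M₀`. A nonzero `x ∈ A_i` generates `A` as a bimodule, so `1 = ∑ a x b` with
the degrees of the `b` bounded by a multiple `c ν(i)` of the return function of the bimodule `A`.
If `x` killed `M_{c ν(i)}`, it would kill all `b M₀`, and then `M₀ = 1 M₀ = 0`. Hence `A_i` embeds
into `Hom(M_{c ν(i)}, M_{c ν(i) + i})`, and
`dim A_i ≤ dim M_{c ν(i)} * dim M_{c ν(i) + i}` (`finrank_algFilt_le`, `exists_returnFun_simple`).
Passing to degrees gives `GK(A) ≤ GK(M) (fdim A + max (fdim A) 1)` if `fdim A` is finite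
(`degree_div_le`).

For the Morita part, let `X` be the `A`-module `A` and `Y` the `A`-module which corresponds to the
`B`-module `B`. Both are separators of the category of `A`-modules, and each of the two becomes the
regular module on one side of the equivalence, so that each is a retract of a finite sum of copies
of the other: `𝟙 X = ∑ u_k ≫ v_k` and `𝟙 Y = ∑ f_j ≫ p_j`
(`exists_sum_comp_eq_id_of_moritaEquivalence`). As `A` and `B` are the endomorphism algebras of `X`
and `Y`, inserting these two sums into a composition writes each element of `B` as a polynomial in
finitely many elements `f u`, `v u`, `v a u`, `v p` (`finiteType_of_sum_comp_eq_id`). Similarly, a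
`B`-module `M ≅ Hom(Y, Z)` corresponds to the `A`-module `N ≅ Hom(X, Z)`; the subspace
`N₀ = ∑ p_j M₀` generates `N`, and `N_i ⊆ ∑ u_k M_{i+1}` for suitable generators of `B`, so that
`GK(N) ≤ GK(M)` (`finite_and_gkDim_le_of_maps`).
-/

namespace FilterDim

/-! ### Degrees of functions -/

section Degree

theorem eventually_le_rpow_of_degree_lt {f : ℕ → ℕ∞} {r : ℝ≥0} (h : degree f < r) :
    ∀ᶠ i : ℕ in atTop, (f i : ℝ≥0∞) ≤ (i : ℝ≥0∞) ^ (r : ℝ) := by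
  obtain ⟨q, hq⟩ := iInf_lt_iff.1 h
  obtain ⟨hq₁, hq₂⟩ := iInf_lt_iff.1 hq
  have hqr : q < r := by exact_mod_cast hq₂
  filter_upwards [hq₁, eventually_ge_atTop 1] with i hi h1
  refine hi.trans (ENNReal.rpow_le_rpow_of_exponent_le ?_ (by exact_mod_cast hqr.le))
  exact_mod_cast h1

theorem degree_le_of_eventually_le_mul_rpow {f : ℕ → ℕ} {r : ℝ≥0} {C : ℝ}
    (h : ∀ᶠ i : ℕ in atTop, (f i : ℝ) ≤ C * (i : ℝ) ^ (r : ℝ)) :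
    degree (fun i => (f i : ℕ∞)) ≤ r := by
  refine ENNReal.le_of_forall_pos_le_add fun ε hε _ => ?_
  rw [← ENNReal.coe_add]
  refine iInf₂_le (r + ε) ?_
  have hlim : Tendsto (fun i : ℕ => ((i : ℝ) ^ (ε : ℝ))) atTop atTop :=
    (tendsto_rpow_atTop (by exact_mod_cast hε)).comp tendsto_natCast_atTop_atTop
  filter_upwards [h, eventually_ge_atTop 1, hlim.eventually_ge_atTop C] with i h1 h2 h3
  have hi : (0 : ℝ) < i := by exact_mod_cast h2
  have key : (f i : ℝ) ≤ (i : ℝ) ^ ((r + ε : ℝ≥0) : ℝ) := by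
    rw [NNReal.coe_add, Real.rpow_add hi, mul_comm]
    exact h1.trans (by gcongr)
  have := ENNReal.ofReal_le_ofReal key
  rw [← ENNReal.ofReal_rpow_of_pos hi] at this
  simpa using this

theorem degree_le_mul_add_of_eventually {f g : ℕ → ℕ} {ν : ℕ → ℕ∞} (hg : Monotone g) {c : ℕ}
    (hc : 1 ≤ c) (h : ∀ i j : ℕ, ν i = j → f i ≤ g (c * j) * g (c * j + i)) {r s : ℝ≥0}
    (hs : 0 < s) (hr' : degree (fun i => (g i : ℕ∞)) < r) (hs' : degree ν < s) :
    degree (fun i => (f i : ℕ∞)) ≤ (r * (s + max s 1) : ℝ≥0) := by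
  have hgr : ∀ᶠ j : ℕ in atTop, (g j : ℝ) ≤ (j : ℝ) ^ (r : ℝ) := by
    filter_upwards [eventually_le_rpow_of_degree_lt hr', eventually_ge_atTop 1] with j hj h1
    have hj' : ((g j : ℕ) : ℝ≥0∞) ≤ (j : ℝ≥0∞) ^ (r : ℝ) := by simpa using hj
    have := ENNReal.toReal_mono (ENNReal.rpow_ne_top_of_nonneg r.2 (by simp)) hj'
    simpa [← ENNReal.toReal_rpow] using this
  have hlim : Tendsto (fun i : ℕ => ⌊(i : ℝ) ^ (s : ℝ)⌋₊) atTop atTop :=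
    tendsto_nat_floor_atTop.comp
      ((tendsto_rpow_atTop (by exact_mod_cast hs)).comp tendsto_natCast_atTop_atTop)
  have hlim₁ : Tendsto (fun i : ℕ => c * ⌊(i : ℝ) ^ (s : ℝ)⌋₊) atTop atTop :=
    tendsto_atTop_mono (fun i => Nat.le_mul_of_pos_left _ hc) hlim
  have hlim₂ : Tendsto (fun i : ℕ => c * ⌊(i : ℝ) ^ (s : ℝ)⌋₊ + i) atTop atTop :=
    tendsto_atTop_mono (fun i => Nat.le_add_right _ _) hlim₁
  refine degree_le_of_eventually_le_mul_rpow (C := (c : ℝ) ^ (r : ℝ) * (c + 1 : ℝ) ^ (r : ℝ)) ?_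
  filter_upwards [eventually_le_rpow_of_degree_lt hs', eventually_ge_atTop 1,
    hlim₁.eventually hgr, hlim₂.eventually hgr] with i h1 h2 h3 h4
  have hi : (1 : ℝ) ≤ i := by exact_mod_cast h2
  have hi0 : (0 : ℝ) < i := by linarith
  obtain ⟨j, hj⟩ : ∃ j : ℕ, ν i = j := by
    refine ENat.ne_top_iff_exists.1 (fun htop => ?_) |>.imp fun _ h => h.symm
    rw [htop, ENat.toENNReal_top, top_le_iff] at h1
    exact ENNReal.rpow_ne_top_of_nonneg s.2 (ENNReal.natCast_ne_top i) h1
  have hjs : (j : ℝ) ≤ (i : ℝ) ^ (s : ℝ) := by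
    rw [hj] at h1
    have := ENNReal.toReal_mono (ENNReal.rpow_ne_top_of_nonneg s.2 (by simp)) h1
    simpa [← ENNReal.toReal_rpow] using this
  have hjJ := Nat.le_floor hjs
  -- `J` bounds `ν i` and tends to infinity with `i`, so that the bound for `g` applies at `c * J`
  set J := ⌊(i : ℝ) ^ (s : ℝ)⌋₊ with hJdef
  have hJ : (J : ℝ) ≤ (i : ℝ) ^ (s : ℝ) := Nat.floor_le (by positivity)
  have hm : (J : ℝ) ≤ (i : ℝ) ^ (max s 1 : ℝ) :=
    hJ.trans (Real.rpow_le_rpow_of_exponent_le hi (le_max_left _ _))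
  have hm' : (i : ℝ) ≤ (i : ℝ) ^ (max s 1 : ℝ) := by
    simpa using Real.rpow_le_rpow_of_exponent_le hi (le_max_right (s : ℝ) 1)
  have e1 : (g (c * j) : ℝ) ≤ (c * (i : ℝ) ^ (s : ℝ)) ^ (r : ℝ) := by
    calc (g (c * j) : ℝ) ≤ g (c * J) := by exact_mod_cast hg (Nat.mul_le_mul_left c hjJ)
      _ ≤ _ := h3
      _ ≤ _ := by
        push_cast
        gcongr
  have e2 : (g (c * j + i) : ℝ) ≤ ((c + 1) * (i : ℝ) ^ (max s 1 : ℝ)) ^ (r : ℝ) := by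
    calc (g (c * j + i) : ℝ) ≤ g (c * J + i) := by
          exact_mod_cast hg (Nat.add_le_add_right (Nat.mul_le_mul_left c hjJ) i)
      _ ≤ _ := h4
      _ ≤ _ := by
        push_cast
        rw [add_mul, one_mul]
        gcongr
  calc (f i : ℝ) ≤ g (c * j) * g (c * j + i) := by exact_mod_cast h i j hj
    _ ≤ (c * (i : ℝ) ^ (s : ℝ)) ^ (r : ℝ) * ((c + 1) * (i : ℝ) ^ (max s 1 : ℝ)) ^ (r : ℝ) := by
      gcongr
    _ = _ := by
      rw [Real.mul_rpow (by positivity) (by positivity),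
        Real.mul_rpow (by positivity) (by positivity), ← Real.rpow_mul hi0.le,
        ← Real.rpow_mul hi0.le, mul_mul_mul_comm, ← Real.rpow_add hi0]
      congr 2
      push_cast
      ring

/-- If `f i ≤ g (c ν(i)) g (c ν(i) + i)` for `ν(i) < ∞`, then `γ(f) ≤ γ(g) (γ(ν) + max (γ(ν)) 1)`
when `γ(ν) < ∞`. The division keeps the case `γ(g) = 0`, `γ(ν) = ∞` true, where nothing follows for
`f` and the product would be `0`. -/
theorem degree_div_le {f g : ℕ → ℕ} {ν : ℕ → ℕ∞} (hg : Monotone g) {c : ℕ} (hc : 1 ≤ c)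
    (h : ∀ i j : ℕ, ν i = j → f i ≤ g (c * j) * g (c * j + i)) :
    degree (fun i => (f i : ℕ∞)) / (degree ν + max (degree ν) 1) ≤
      degree (fun i => (g i : ℕ∞)) := by
  rcases eq_or_ne (degree ν) ∞ with hν | hν
  · simp [hν]
  rcases eq_or_ne (degree fun i => (g i : ℕ∞)) ∞ with hG | hG
  · simp [hG]
  refine ENNReal.div_le_of_le_mul ?_
  lift degree ν to ℝ≥0 using hν with d hd
  lift degree (fun i => (g i : ℕ∞)) to ℝ≥0 using hG with q hq
  have key : ∀ δ : ℝ≥0, 0 < δ → degree (fun i => (f i : ℕ∞)) ≤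
      ((q + δ) * ((d + δ) + max (d + δ) 1) : ℝ≥0) := fun δ hδ =>
    degree_le_mul_add_of_eventually hg hc h (by positivity)
      (by rw [← hq]; exact_mod_cast lt_add_of_pos_right q hδ)
      (by rw [← hd]; exact_mod_cast lt_add_of_pos_right d hδ)
  have hcont : Continuous fun δ : ℝ≥0 => (((q + δ) * ((d + δ) + max (d + δ) 1) : ℝ≥0) : ℝ≥0∞) :=
    ENNReal.continuous_coe.comp (by fun_prop)
  have hlim := (hcont.tendsto 0).mono_left (nhdsWithin_le_nhds (s := Set.Ioi 0))
  have := ge_of_tendsto hlim (eventually_mem_nhdsWithin.mono fun δ hδ => key δ hδ)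
  simpa using this

end Degree

/-! ### Modules over simple algebras -/

section Simple

variable {K : Type u} [Field K] {A : Type v} [Ring A] [Algebra K A]

/-- The span of the `a ⊗ b` in the enveloping algebra `A ⊗ Aᵐᵒᵖ` with `a` arbitrary and `b` in the
`i`-th term of the standard filtration of `A`. -/
def rightFilt (s : Finset A) (i : ℕ) : Submodule K (A ⊗[K] Aᵐᵒᵖ) :=
  Submodule.span K {z | ∃ a : A, ∃ b ∈ algFilt K s i, z = a ⊗ₜ[K] MulOpposite.op b}

theorem rightFilt_mono (s : Finset A) : Monotone (rightFilt (K := K) s) := fun _ _ h =>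
  Submodule.span_mono fun _ ⟨a, b, hb, hz⟩ => ⟨a, b, algFilt_mono s h hb, hz⟩

theorem rightFilt_mul_le (s : Finset A) (i j : ℕ) :
    rightFilt (K := K) s i * rightFilt s j ≤ rightFilt s (i + j) := by
  rw [rightFilt, rightFilt, Submodule.span_mul_span]
  refine Submodule.span_mono ?_
  rintro _ ⟨_, ⟨a, b, hb, rfl⟩, _, ⟨a', b', hb', rfl⟩, rfl⟩
  refine ⟨a * a', b' * b, ?_, by simp⟩
  rw [algFilt, add_comm, pow_add]
  exact Submodule.mul_mem_mul hb' hb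

theorem exists_mem_rightFilt {s : Finset A} (hs : Generates K s) (z : A ⊗[K] Aᵐᵒᵖ) :
    ∃ i, z ∈ rightFilt (K := K) s i := by
  induction z with
  | zero => exact ⟨0, zero_mem _⟩
  | tmul a b =>
    obtain ⟨i, hi⟩ := exists_mem_algFilt hs b.unop
    exact ⟨i, Submodule.subset_span ⟨a, b.unop, hi, by simp⟩⟩
  | add x y hx hy =>
    obtain ⟨i, hi⟩ := hx
    obtain ⟨j, hj⟩ := hy
    exact ⟨max i j, add_mem (rightFilt_mono s (le_max_left _ _) hi)
      (rightFilt_mono s (le_max_right _ _) hj)⟩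

theorem exists_algFilt_le_rightFilt {s : Finset A} (hs : Generates K s)
    (t : Finset (A ⊗[K] Aᵐᵒᵖ)) :
    ∃ c, 1 ≤ c ∧ ∀ j, algFilt K t j ≤ rightFilt (K := K) s (c * j) := by
  choose n hn using exists_mem_rightFilt hs
  have h1 : ∀ i, (1 : Submodule K (A ⊗[K] Aᵐᵒᵖ)) ≤ rightFilt s i := fun i => by
    rw [Submodule.one_le]
    exact Submodule.subset_span ⟨1, 1, Submodule.one_le.1 (one_le_algFilt s i), rfl⟩
  refine ⟨t.sup n + 1, by omega, fun j => ?_⟩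
  induction j with
  | zero => simpa [algFilt] using h1 0
  | succ j ih =>
    rw [algFilt, pow_succ, mul_add_one]
    refine (mul_le_mul' ih (sup_le (h1 _) (Submodule.span_le.2 fun z hz => ?_))).trans
      (rightFilt_mul_le s _ _)
    exact rightFilt_mono s ((Finset.le_sup (f := n) hz).trans (Nat.le_succ _)) (hn z)

/-- A nonzero element of a simple algebra generates it as a bimodule. -/
theorem exists_mulLeftRight_eq [IsSimpleRing A] {x : A} (hx : x ≠ 0) (y : A) :
    ∃ z, AlgHom.mulLeftRight K A z x = y := by
  have hmul : ∀ z w, AlgHom.mulLeftRight K A (z * w) x =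
      AlgHom.mulLeftRight K A z (AlgHom.mulLeftRight K A w x) := fun z w => by
    rw [map_mul]; rfl
  let I : TwoSidedIdeal A := TwoSidedIdeal.mk' {y | ∃ z, AlgHom.mulLeftRight K A z x = y}
    ⟨0, by simp⟩
    (by rintro _ _ ⟨z, rfl⟩ ⟨w, rfl⟩; exact ⟨z + w, by simp⟩)
    (by rintro _ ⟨z, rfl⟩; exact ⟨-z, by simp⟩)
    (by rintro a _ ⟨z, rfl⟩; exact ⟨(a ⊗ₜ 1) * z, by rw [hmul]; simp⟩)
    (by rintro _ a ⟨z, rfl⟩; exact ⟨(1 ⊗ₜ MulOpposite.op a) * z, by rw [hmul]; simp⟩)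
  have hxI : x ∈ I := (TwoSidedIdeal.mem_mk' ..).2 ⟨1, by simp⟩
  have h1 := IsSimpleRing.one_mem_of_ne_zero_mem I hx hxI
  have hy : y ∈ I := by simpa using I.mul_mem_left y 1 h1
  exact (TwoSidedIdeal.mem_mk' {y | ∃ z, AlgHom.mulLeftRight K A z x = y} ..).1 hy

/-- In a simple algebra, the return function of the bimodule `A` bounds the degree of the right
coefficients needed to write `1` as `∑ a x b` for a nonzero `x` in `A_i`, up to a constant factor
which accounts for the choice of generators of `A ⊗ Aᵐᵒᵖ`. -/
theorem exists_returnFun_simple [IsSimpleRing A] [Algebra.FiniteType K A] {s : Finset A}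
    (hs : Generates K s) :
    ∃ (ν : ℕ → ℕ∞) (c : ℕ), degree ν = fdim K A ∧ 1 ≤ c ∧ ∀ i j : ℕ, ν i = j →
      ∀ x ∈ algFilt K s i, x ≠ 0 →
        ∃ z ∈ rightFilt s (c * j), AlgHom.mulLeftRight K A z x = 1 := by
  classical
  let _ : Module (A ⊗[K] Aᵐᵒᵖ) A := instModuleTensorProductMop K A
  have : IsScalarTower K (A ⊗[K] Aᵐᵒᵖ) A :=
    ⟨fun r x a => by
      change TensorProduct.Algebra.moduleAux _ _ = _ • TensorProduct.Algebra.moduleAux _ _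
      simp⟩
  have hsmul : ∀ (z : A ⊗[K] Aᵐᵒᵖ) (x : A), z • x = AlgHom.mulLeftRight K A z x :=
    fun _ _ => rfl
  obtain ⟨t₀, ht₀⟩ := (finiteType_tensor_mop K A).out
  let l : A →ₐ[K] A ⊗[K] Aᵐᵒᵖ := Algebra.TensorProduct.includeLeft
  set t := t₀ ∪ s.image l with htdef
  have ht : Generates K t :=
    top_le_iff.1 (ht₀ ▸ Algebra.adjoin_mono (by simp [htdef]))
  obtain ⟨c, hc, hct⟩ := exists_algFilt_le_rightFilt hs t
  -- the filtration of `A` lies in its filtration as a bimodule, since `t` contains `s ⊗ 1`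
  have hle : ∀ i, algFilt K s i ≤ modFilt K t (1 : Submodule K A) i := by
    intro i x hx
    have hl : (algFilt K s i).map l.toLinearMap ≤ algFilt K t i := by
      rw [algFilt, algFilt, Submodule.map_pow]
      refine pow_le_pow_left' ?_ i
      rw [Submodule.map_sup, Submodule.map_one, Submodule.map_span]
      refine sup_le_sup le_rfl (Submodule.span_mono ?_)
      simp [htdef]
    have h2 := Submodule.smul_mem_smul (hl (Submodule.mem_map_of_mem hx))
      (Submodule.one_le.1 (le_refl (1 : Submodule K A)))
    have h3 : l.toLinearMap x • (1 : A) = x := by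
      rw [hsmul]
      simp [l]
    rwa [h3] at h2
  have hg : ∀ x : A, x ≠ 0 → GeneratesModule K (A ⊗[K] Aᵐᵒᵖ) (Submodule.span K {x}) := by
    intro x hx
    refine top_le_iff.1 fun y _ => ?_
    obtain ⟨z, rfl⟩ := exists_mulLeftRight_eq (K := K) hx y
    rw [← hsmul]
    exact Submodule.smul_mem _ z (Submodule.subset_span (Submodule.mem_span_singleton_self x))
  have hg1 : GeneratesModule K (A ⊗[K] Aᵐᵒᵖ) (1 : Submodule K A) := by
    rw [Submodule.one_eq_span]
    exact hg 1 one_ne_zero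
  refine ⟨returnFun K t (1 : Submodule K A), c, (fdimMod_eq ht fg_one hg1).symm, hc,
    fun i j hij x hx hx0 => ?_⟩
  have h1 := returnFun_spec t (1 : Submodule K A) i j hij (Submodule.span K {x})
    ((Submodule.span_singleton_le_iff_mem _ _).2 (hle i hx)) (hg x hx0)
    (Submodule.one_le.1 le_rfl)
  obtain ⟨z, hz, hz1⟩ : ∃ z ∈ algFilt K t j, z • x = 1 := by
    have : algFilt K t j • Submodule.span K {x} ≤
        (algFilt K t j).map ((LinearMap.toSpanSingleton (A ⊗[K] Aᵐᵒᵖ) A x).restrictScalars K) := by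
      rw [Submodule.smul_le]
      intro z hz y hy
      obtain ⟨k, rfl⟩ := Submodule.mem_span_singleton.1 hy
      refine ⟨k • z, Submodule.smul_mem _ k hz, ?_⟩
      change (k • z) • x = z • k • x
      rw [hsmul, hsmul, map_smul, map_smul]
      rfl
    exact this h1
  exact ⟨z, hct j hz, by rw [← hsmul, hz1]⟩

/-- If `x` kills `A_i M₀`, then each `∑ a x b` with the `b` in `A_i` kills `M₀`. -/
theorem mulLeftRight_smul_eq_zero {M : Type w} [AddCommGroup M] [Module K M] [Module A M]
    [IsScalarTower K A M] {s : Finset A} {M₀ : Submodule K M} {i : ℕ} {x : A}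
    (hx : ∀ m ∈ modFilt K s M₀ i, x • m = 0) {z : A ⊗[K] Aᵐᵒᵖ} (hz : z ∈ rightFilt s i)
    {m : M} (hm : m ∈ M₀) : AlgHom.mulLeftRight K A z x • m = 0 := by
  induction hz using Submodule.span_induction with
  | mem z hz =>
    obtain ⟨a, b, hb, rfl⟩ := hz
    rw [AlgHom.mulLeftRight_apply, MulOpposite.unop_op, mul_smul, mul_smul,
      hx _ (Submodule.smul_mem_smul hb hm), smul_zero]
  | zero => simp
  | add y z _ _ hy hz => rw [map_add, LinearMap.add_apply, add_smul, hy, hz, add_zero]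
  | smul k z _ hz => rw [map_smul, LinearMap.smul_apply, smul_assoc, hz, smul_zero]

theorem exists_fg_generatesModule (K : Type u) [Field K] (A : Type v) [Ring A] [Algebra K A]
    (M : Type w) [AddCommGroup M] [Module K M] [Module A M]
    [IsScalarTower K A M] [hM : Module.Finite A M] :
    ∃ M₀ : Submodule K M, M₀.FG ∧ GeneratesModule K A M₀ := by
  obtain ⟨t, ht⟩ := hM.fg_top
  exact ⟨Submodule.span K t, ⟨t, rfl⟩, by rw [GeneratesModule, Submodule.span_span_of_tower, ht]⟩

theorem finrank_algFilt_le {M : Type w} [AddCommGroup M] [Module K M] [Module A M]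
    [IsScalarTower K A M] {s : Finset A} {M₀ : Submodule K M} (hM₀ : M₀.FG) {i j : ℕ}
    (h : ∀ x ∈ algFilt K s i, (∀ m ∈ modFilt K s M₀ j, x • m = 0) → x = 0) :
    Module.finrank K (algFilt K s i) ≤
      Module.finrank K (modFilt K s M₀ j) * Module.finrank K (modFilt K s M₀ (j + i)) := by
  have : Module.Finite K (algFilt K s i) := Module.Finite.iff_fg.2 (algFilt_fg s i)
  have : Module.Finite K (modFilt K s M₀ j) := Module.Finite.iff_fg.2 (modFilt_fg s hM₀ _)
  have : Module.Finite K (modFilt K s M₀ (j + i)) := Module.Finite.iff_fg.2 (modFilt_fg s hM₀ _)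
  have hmem : ∀ (x : algFilt K s i) (m : modFilt K s M₀ j),
      (x : A) • (m : M) ∈ modFilt K s M₀ (j + i) := fun x m => by
    rw [modFilt, add_comm, ← algFilt_smul_smul]
    exact Submodule.smul_mem_smul x.2 m.2
  let φ : algFilt K s i →ₗ[K] modFilt K s M₀ j →ₗ[K] modFilt K s M₀ (j + i) :=
    LinearMap.mk₂ K (fun x m => ⟨(x : A) • (m : M), hmem x m⟩)
      (fun x y m => Subtype.ext (add_smul _ _ _))
      (fun k x m => Subtype.ext (smul_assoc _ _ _))
      (fun x m n => Subtype.ext (smul_add _ _ _))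
      (fun k x m => Subtype.ext (by
        change (x : A) • k • (m : M) = k • (x : A) • (m : M)
        rw [← algebraMap_smul A k, ← mul_smul, ← Algebra.commutes, mul_smul, algebraMap_smul]))
  have hφ : Function.Injective φ := by
    rw [injective_iff_map_eq_zero]
    intro x hx
    refine Subtype.ext (h x x.2 fun m hm => ?_)
    have := LinearMap.congr_fun hx ⟨m, hm⟩
    exact congrArg Subtype.val this
  rw [← Module.finrank_linearMap K K]
  exact LinearMap.finrank_le_finrank_of_injective hφ

/-- The lower bound for the Gelfand-Kirillov dimension of a nonzero finitely generated module over a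
simple algebra: an element of `A_i` which kills a large enough `M_j` is `0`. -/
theorem gkDimAlg_div_le_gkDim [IsSimpleRing A] [hA : Algebra.FiniteType K A] {M : Type w}
    [AddCommGroup M] [Module K M] [Module A M] [IsScalarTower K A M] [Module.Finite A M]
    [Nontrivial M] :
    gkDimAlg K A / (fdim K A + max (fdim K A) 1) ≤ gkDim K A M := by
  obtain ⟨s, hs⟩ := hA.out
  obtain ⟨M₀, hM₀, hgen⟩ := exists_fg_generatesModule K A M
  obtain ⟨ν, c, hν, hc, key⟩ := exists_returnFun_simple (K := K) hs
  rw [gkDim_eq hs hM₀ hgen, gkDimAlg_eq hs, ← hν]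
  have hne : ∃ m ∈ M₀, m ≠ 0 := by
    by_contra! hcon
    have : M₀ = ⊥ := (Submodule.eq_bot_iff _).2 hcon
    rw [GeneratesModule, this] at hgen
    simp at hgen
  refine degree_div_le (fun i j hij => ?_) hc fun i j hij => ?_
  · have : Module.Finite K (modFilt K s M₀ j) := Module.Finite.iff_fg.2 (modFilt_fg s hM₀ _)
    exact Submodule.finrank_mono (Submodule.smul_mono_left (algFilt_mono s hij))
  · refine finrank_algFilt_le hM₀ fun x hx hkill => ?_
    by_contra hx0
    obtain ⟨m, hm, hm0⟩ := hne
    obtain ⟨z, hz, hz1⟩ := key i j hij x hx hx0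
    apply hm0
    rw [← one_smul A m, ← hz1]
    exact mulLeftRight_smul_eq_zero hkill hz hm

end Simple

/-! ### Comparison of growth along maps -/

section Change

variable {K : Type u} [Field K]

theorem modFilt_succ {A : Type*} [Ring A] [Algebra K A] {M : Type*} [AddCommGroup M] [Module K M]
    [Module A M] [IsScalarTower K A M] (s : Finset A) (M₀ : Submodule K M) (i : ℕ) :
    modFilt K s M₀ (i + 1) = algFilt K s 1 • modFilt K s M₀ i := by
  rw [modFilt, modFilt, algFilt_smul_smul, add_comm]

theorem gkDim_le_of_surjective {A : Type*} [Ring A] [Algebra K A] [hA : Algebra.FiniteType K A]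
    {M N : Type*} [AddCommGroup M] [Module K M] [Module A M] [IsScalarTower K A M]
    [Module.Finite A M] [AddCommGroup N] [Module K N] [Module A N] [IsScalarTower K A N]
    (f : M →ₗ[A] N) (hf : Function.Surjective f) : gkDim K A N ≤ gkDim K A M := by
  obtain ⟨s, hs⟩ := hA.out
  obtain ⟨M₀, hM₀, hgen⟩ := exists_fg_generatesModule K A M
  let g : M →ₗ[K] N := f.restrictScalars K
  have hgen' : GeneratesModule K A (M₀.map g) := by
    have : ((M₀.map g : Submodule K N) : Set N) = f '' M₀ := rfl
    rw [GeneratesModule, this, Submodule.span_image, hgen, Submodule.map_top,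
      LinearMap.range_eq_top.2 hf]
  rw [gkDim_eq hs hM₀ hgen, gkDim_eq hs (hM₀.map g) hgen']
  refine degree_le_of_le le_rfl fun i => ?_
  have : Module.Finite K (modFilt K s M₀ i) := Module.Finite.iff_fg.2 (modFilt_fg s hM₀ _)
  have hle : modFilt K s (M₀.map g) i ≤ (modFilt K s M₀ i).map g := by
    rw [modFilt, Submodule.smul_le]
    rintro a ha _ ⟨m, hm, rfl⟩
    exact ⟨a • m, Submodule.smul_mem_smul ha hm, f.map_smul a m⟩
  have hmono : modFilt K s M₀ i ≤ modFilt K s M₀ (1 * i + 1) :=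
    Submodule.smul_mono_left (algFilt_mono s (by omega))
  have : Module.Finite K (modFilt K s M₀ (1 * i + 1)) :=
    Module.Finite.iff_fg.2 (modFilt_fg s hM₀ _)
  have h1 := (Submodule.finrank_mono hle).trans (Submodule.finrank_map_le g _)
  have h2 := h1.trans (Submodule.finrank_mono hmono)
  norm_cast
  omega

theorem finrank_iSup_map_le {M N : Type*} [AddCommGroup M] [Module K M] [AddCommGroup N]
    [Module K N] {ι : Type*} [Fintype ι] (U : ι → M →ₗ[K] N) (W : Submodule K M)
    [Module.Finite K W] :
    Module.finrank K (⨆ k, W.map (U k) : Submodule K N) ≤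
      Fintype.card ι * Module.finrank K W := by
  classical
  let L : (ι → W) →ₗ[K] N := ∑ k, (U k ∘ₗ W.subtype) ∘ₗ LinearMap.proj k
  have hle : ⨆ k, W.map (U k) ≤ LinearMap.range L := by
    refine iSup_le fun k => ?_
    rintro _ ⟨m, hm, rfl⟩
    refine ⟨Pi.single k ⟨m, hm⟩, ?_⟩
    rw [LinearMap.sum_apply, Finset.sum_eq_single k]
    · simp
    · intro l _ hl
      simp [Pi.single_eq_of_ne hl]
    · simp
  calc _ ≤ Module.finrank K (LinearMap.range L) := Submodule.finrank_mono hle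
    _ ≤ Module.finrank K (ι → W) := LinearMap.finrank_range_le L
    _ = _ := by simp [Module.finrank_pi_fintype]

/-- The comparison of growth for Morita equivalent algebras, in terms of finitely many maps
between a `B`-module `M` and the corresponding `A`-module `N`. The maps `U k` and `P j` from `M` to
`N` come from homomorphisms of the two progenerators, and `V k` and `F j` from homomorphisms in the
other direction; `V k ∘ a ∘ U l` and `V k ∘ P j` are multiplications by elements of `B`, and
`U k ∘ b ∘ F j` is the multiplication by an element of `A`. -/
theorem finite_and_gkDim_le_of_maps {A : Type*} [Ring A] [Algebra K A]
    [hA : Algebra.FiniteType K A] {B : Type*} [Ring B] [Algebra K B]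
    [hB : Algebra.FiniteType K B] {M N : Type*} [AddCommGroup M] [Module K M]
    [Module B M] [IsScalarTower K B M] [Module.Finite B M] [AddCommGroup N] [Module K N]
    [Module A N] [IsScalarTower K A N] {ι κ : Type*} [Fintype ι] [Fintype κ]
    (U : ι → M →ₗ[K] N) (V : ι → N → M) (P : κ → M →ₗ[K] N) (F : κ → N → M)
    (hUV : ∀ n, ∑ k, U k (V k n) = n) (hFP : ∀ m, ∑ j, F j (P j m) = m)
    (hVU : ∀ (a : A) (k l), ∃ b : B, ∀ m, V k (a • U l m) = b • m)
    (hVP : ∀ k j, ∃ b : B, ∀ m, V k (P j m) = b • m)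
    (hUF : ∀ (b : B) (k j), ∃ a : A, ∀ n, U k (b • F j n) = a • n) :
    Module.Finite A N ∧ gkDim K A N ≤ gkDim K B M := by
  classical
  obtain ⟨s, hs⟩ := hA.out
  obtain ⟨t₀, ht₀⟩ := hB.out
  obtain ⟨M₀, hM₀, hgen⟩ := exists_fg_generatesModule K B M
  choose β hβ using hVU
  choose γ hγ using hVP
  choose α hα using hUF
  -- the generators of `B` are chosen so that they include the coefficients that occur
  set t : Finset B := t₀ ∪ Finset.univ.biUnion (fun k => Finset.univ.biUnion fun l =>
    s.image fun a => β a k l) ∪ Finset.univ.biUnion (fun k => Finset.univ.image fun j => γ k j)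
    with htdef
  have ht : Generates K t := top_le_iff.1 (ht₀ ▸ Algebra.adjoin_mono (by
    rw [htdef, Finset.coe_union, Finset.coe_union, Set.union_assoc]
    exact Set.subset_union_left))
  have hβt : ∀ a ∈ s, ∀ k l, β a k l ∈ algFilt K t 1 := fun a ha k l => by
    rw [algFilt, pow_one]
    refine Submodule.mem_sup_right (Submodule.subset_span ?_)
    rw [htdef]
    simp only [Finset.coe_union]
    exact Or.inl (Or.inr (by simpa using ⟨k, l, a, ha, rfl⟩))
  have hγt : ∀ k j, γ k j ∈ algFilt K t 1 := fun k j => by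
    rw [algFilt, pow_one]
    refine Submodule.mem_sup_right (Submodule.subset_span ?_)
    rw [htdef]
    simp only [Finset.coe_union]
    exact Or.inr (by simp)
  set N₀ : Submodule K N := ⨆ j, M₀.map (P j) with hN₀def
  have hN₀ : N₀.FG := Submodule.fg_iSup _ fun j => hM₀.map (P j)
  have hmemN₀ : ∀ j, ∀ m ∈ M₀, P j m ∈ N₀ := fun j m hm =>
    Submodule.mem_iSup_of_mem j (Submodule.mem_map_of_mem hm)
  have hUP : ∀ (b : B) (k) (m), U k (b • m) = ∑ j, α b k j • P j m := fun b k m => by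
    conv_lhs => rw [← hFP m, Finset.smul_sum, map_sum]
    exact Finset.sum_congr rfl fun j _ => hα b k j _
  have hgenN : GeneratesModule K A N₀ := by
    refine top_le_iff.1 fun n _ => ?_
    rw [← hUV n]
    refine Submodule.sum_mem _ fun k _ => ?_
    have hV : V k n ∈ Submodule.span B (M₀ : Set M) := by rw [hgen]; trivial
    refine Submodule.span_induction (p := fun m _ => ∀ b : B,
      U k (b • m) ∈ Submodule.span A (N₀ : Set N)) ?_ ?_ ?_ ?_ hV 1 |> (by simpa using ·)
    · intro m hm b
      rw [hUP]
      exact Submodule.sum_mem _ fun j _ =>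
        Submodule.smul_mem _ _ (Submodule.subset_span (hmemN₀ j m hm))
    · intro b
      rw [smul_zero, map_zero]
      exact zero_mem _
    · intro x y _ _ hx hy b
      rw [smul_add, map_add]
      exact add_mem (hx b) (hy b)
    · intro b' x _ hx b
      rw [← mul_smul]
      exact hx _
  have hle : ∀ i, modFilt K s N₀ i ≤ ⨆ k, (modFilt K t M₀ (i + 1)).map (U k) := by
    intro i
    induction i with
    | zero =>
      rw [modFilt, algFilt, pow_zero, Submodule.one_smul, zero_add]
      refine iSup_le fun j => ?_
      rintro _ ⟨m, hm, rfl⟩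
      rw [← hUV (P j m)]
      refine Submodule.sum_mem _ fun k _ => Submodule.mem_iSup_of_mem k ?_
      rw [hγ]
      exact Submodule.mem_map_of_mem (Submodule.smul_mem_smul (hγt k j) hm)
    | succ i ih =>
      have hstep : ⨆ k, (modFilt K t M₀ (i + 1)).map (U k) ≤
          ⨆ k, (modFilt K t M₀ (i + 1 + 1)).map (U k) := iSup_mono fun k =>
        Submodule.map_mono (Submodule.smul_mono_left (algFilt_mono t (Nat.le_succ _)))
      rw [modFilt_succ, algFilt, pow_one, Submodule.sup_smul, Submodule.one_smul]
      refine sup_le (ih.trans hstep) ?_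
      rw [Submodule.smul_le]
      intro a ha n hn
      induction ha using Submodule.span_induction with
      | mem a ha =>
        refine Submodule.iSup_induction _ (motive := fun n => a • n ∈ _) (ih hn) ?_ ?_ ?_
        · rintro l _ ⟨m, hm, rfl⟩
          rw [← hUV (a • U l m)]
          refine Submodule.sum_mem _ fun k _ => Submodule.mem_iSup_of_mem k ?_
          rw [hβ, modFilt_succ]
          exact Submodule.mem_map_of_mem (Submodule.smul_mem_smul (hβt a ha k l) hm)
        · rw [smul_zero]
          exact zero_mem _
        · intro x y hx hy
          rw [smul_add]
          exact add_mem hx hy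
      | zero => rw [zero_smul]; exact zero_mem _
      | add x y _ _ hx hy => rw [add_smul]; exact add_mem hx hy
      | smul r x _ hx => rw [smul_assoc]; exact Submodule.smul_mem _ _ hx
  refine ⟨⟨?_⟩, ?_⟩
  · obtain ⟨T, hT⟩ := hN₀
    refine ⟨T, ?_⟩
    rw [← Submodule.span_span_of_tower K A (T : Set N), hT]
    exact hgenN
  · rw [gkDim_eq hs hN₀ hgenN, gkDim_eq ht hM₀ hgen]
    refine degree_le_of_le (c := Fintype.card ι + 1) (by omega) fun i => ?_
    have hfin : ∀ i, Module.Finite K (modFilt K t M₀ i) := fun i =>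
      Module.Finite.iff_fg.2 (modFilt_fg t hM₀ _)
    have h1 : Module.finrank K (modFilt K s N₀ i) ≤
        Fintype.card ι * Module.finrank K (modFilt K t M₀ (i + 1)) := by
      have hsup : Module.Finite K (⨆ k, (modFilt K t M₀ (i + 1)).map (U k) : Submodule K N) :=
        Module.Finite.iff_fg.2 (Submodule.fg_iSup _ fun k => (modFilt_fg t hM₀ _).map _)
      exact (Submodule.finrank_mono (hle i)).trans (finrank_iSup_map_le U _)
    have h2 : Module.finrank K (modFilt K t M₀ (i + 1)) ≤ Module.finrank K
        (modFilt K t M₀ ((Fintype.card ι + 1) * i + (Fintype.card ι + 1))) :=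
      Submodule.finrank_mono (Submodule.smul_mono_left (algFilt_mono t (by nlinarith)))
    norm_cast
    nlinarith [Nat.mul_le_mul_left (Fintype.card ι) h2]

/-- The holonomic number also bounds the modules outside the universe of the algebra. -/
theorem holonomicNumber_le_gkDim {A : Type v} [Ring A] [Algebra K A] [Algebra.FiniteType K A]
    (N : Type w) [AddCommGroup N] [Module K N] [Module A N] [IsScalarTower K A N]
    [Module.Finite A N] [Nontrivial N] : holonomicNumber K A ≤ gkDim K A N := by
  obtain ⟨n, f, hf⟩ := Module.Finite.exists_fin' A N
  let e := f.quotKerEquivOfSurjective hf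
  have : Nontrivial ((Fin n → A) ⧸ LinearMap.ker f) := e.toEquiv.nontrivial
  refine le_trans ?_ (gkDim_le_of_surjective (K := K) e.symm.toLinearMap e.symm.surjective)
  exact iInf_le_of_le ((Fin n → A) ⧸ LinearMap.ker f) (iInf_le_of_le inferInstance
    (iInf_le_of_le inferInstance (iInf_le_of_le inferInstance (iInf_le_of_le inferInstance
    (iInf_le_of_le inferInstance (iInf_le_of_le inferInstance le_rfl))))))

end Change

/-! ### Algebras and modules of homomorphisms in a linear category -/

section Category

open CategoryTheory

variable {K : Type u} [Field K] {A : Type*} [Ring A] [Algebra K A] {B : Type*} [Ring B]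
  [Algebra K B] {C : Type*} [Category* C] [Preadditive C] [CategoryTheory.Linear K C] {X Y : C}
  {ι κ : Type*} [Fintype ι] [Fintype κ]

/-- If each of `X` and `Y` is a retract of a finite sum of copies of the other one, then finite
generation passes from the endomorphism algebra `A` of `X` to the endomorphism algebra `B` of `Y`
(both with the composition in the diagrammatic order as their product). -/
theorem finiteType_of_sum_comp_eq_id [hA : Algebra.FiniteType K A]
    (ρ : A ≃ₗ[K] (X ⟶ X)) (hρ : ∀ a b, ρ (a * b) = ρ a ≫ ρ b)
    (θ : B ≃ₗ[K] (Y ⟶ Y)) (hθ : ∀ a b, θ (a * b) = θ a ≫ θ b)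
    (u : ι → (X ⟶ Y)) (v : ι → (Y ⟶ X)) (huv : ∑ k, u k ≫ v k = 𝟙 X)
    (f : κ → (Y ⟶ X)) (p : κ → (X ⟶ Y)) (hfp : ∑ j, f j ≫ p j = 𝟙 Y) :
    Algebra.FiniteType K B := by
  classical
  obtain ⟨s, hs⟩ := hA.out
  have hθ' : ∀ x y, θ.symm (x ≫ y) = θ.symm x * θ.symm y := fun x y => by
    apply θ.injective
    simp [hθ]
  let t : Finset B :=
    Finset.univ.biUnion (fun j => Finset.univ.image fun k => θ.symm (f j ≫ u k)) ∪
    Finset.univ.biUnion (fun k => Finset.univ.image fun j => θ.symm (v k ≫ p j)) ∪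
    Finset.univ.biUnion (fun k => Finset.univ.image fun l => θ.symm (v k ≫ u l)) ∪
    Finset.univ.biUnion (fun k => Finset.univ.biUnion fun l =>
      s.image fun a => θ.symm (v k ≫ ρ a ≫ u l))
  set S := Algebra.adjoin K (t : Set B) with hS
  have hfu : ∀ j k, θ.symm (f j ≫ u k) ∈ S := fun j k => Algebra.subset_adjoin (by simp [t])
  have hvp : ∀ k j, θ.symm (v k ≫ p j) ∈ S := fun k j => Algebra.subset_adjoin (by simp [t])
  have hvu : ∀ k l, θ.symm (v k ≫ u l) ∈ S := fun k l => Algebra.subset_adjoin (by simp [t])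
  have hva : ∀ a ∈ s, ∀ k l, θ.symm (v k ≫ ρ a ≫ u l) ∈ S := fun a ha k l =>
    Algebra.subset_adjoin (Finset.mem_coe.2 (Finset.mem_union_right _ (by
      simp only [Finset.mem_biUnion, Finset.mem_image]
      exact ⟨k, Finset.mem_univ k, l, Finset.mem_univ l, a, ha, rfl⟩)))
  -- insert `1 = ∑ u ≫ v` between two factors
  have hins : ∀ {W W' : C} (x : W ⟶ X) (y : X ⟶ W'), x ≫ y = ∑ k, (x ≫ u k) ≫ v k ≫ y :=
    fun x y => by
      conv_lhs => rw [← Category.id_comp y, ← huv, Preadditive.sum_comp, Preadditive.comp_sum]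
      simp
  have hρ1 : ρ 1 = 𝟙 X := by
    have := hρ 1 (ρ.symm (𝟙 X))
    simpa using this.symm
  have hvau : ∀ (a : A) (k l), θ.symm (v k ≫ ρ a ≫ u l) ∈ S := by
    intro a
    have ha : a ∈ Algebra.adjoin K (s : Set A) := hs ▸ Algebra.mem_top
    induction ha using Algebra.adjoin_induction with
    | mem a ha => exact hva a ha
    | algebraMap r =>
      intro k l
      rw [Algebra.algebraMap_eq_smul_one, map_smul, hρ1, Linear.smul_comp, Linear.comp_smul,
        map_smul, Category.id_comp]
      exact S.smul_mem (hvu k l) r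
    | add x y _ _ hx hy =>
      intro k l
      rw [map_add, Preadditive.add_comp, Preadditive.comp_add, map_add]
      exact add_mem (hx k l) (hy k l)
    | mul x y _ _ hx hy =>
      intro k l
      rw [hρ, Category.assoc, ← Category.assoc, hins, map_sum]
      refine sum_mem fun m _ => ?_
      rw [hθ', Category.assoc]
      exact mul_mem (hx k m) (hy m l)
  have hfap : ∀ (a : A) (j j'), θ.symm (f j ≫ ρ a ≫ p j') ∈ S := by
    intro a j j'
    rw [hins (f j) (ρ a ≫ p j'), map_sum]
    refine sum_mem fun k _ => ?_
    rw [hθ', ← Category.assoc (v k), hins (v k ≫ ρ a) (p j'), map_sum]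
    refine mul_mem (hfu j k) (sum_mem fun l _ => ?_)
    rw [hθ', Category.assoc]
    exact mul_mem (hvau a k l) (hvp l j')
  refine ⟨t, top_le_iff.1 fun b _ => ?_⟩
  have hb : b = ∑ j, ∑ j', θ.symm (f j ≫ ρ (ρ.symm (p j ≫ θ b ≫ f j')) ≫ p j') := by
    apply θ.injective
    simp only [map_sum, LinearEquiv.apply_symm_apply, Category.assoc]
    simp only [← Preadditive.comp_sum, hfp, Category.comp_id]
    simp only [← Category.assoc, ← Preadditive.sum_comp, hfp, Category.id_comp]
  rw [hb]
  exact sum_mem fun j _ => sum_mem fun j' _ => hfap _ j j'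

/-- If `X` and `Y` are retracts of finite sums of copies of each other, then the module `Hom(X, Z)`
over the endomorphism algebra of `X` grows at most as fast as the module `Hom(Y, Z)` over the
endomorphism algebra of `Y`. -/
theorem finite_and_gkDim_le_of_sum_comp_eq_id [Algebra.FiniteType K A] [Algebra.FiniteType K B]
    {Z : C} {M N : Type*} [AddCommGroup M] [Module K M]
    [Module B M] [IsScalarTower K B M] [Module.Finite B M] [AddCommGroup N] [Module K N]
    [Module A N] [IsScalarTower K A N]
    (ρ : A ≃ₗ[K] (X ⟶ X)) (θ : B ≃ₗ[K] (Y ⟶ Y))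
    (σ : N ≃ₗ[K] (X ⟶ Z)) (hσ : ∀ a n, σ (a • n) = ρ a ≫ σ n)
    (τ : M ≃ₗ[K] (Y ⟶ Z)) (hτ : ∀ b m, τ (b • m) = θ b ≫ τ m)
    (u : ι → (X ⟶ Y)) (v : ι → (Y ⟶ X)) (huv : ∑ k, u k ≫ v k = 𝟙 X)
    (f : κ → (Y ⟶ X)) (p : κ → (X ⟶ Y)) (hfp : ∑ j, f j ≫ p j = 𝟙 Y) :
    Module.Finite A N ∧ gkDim K A N ≤ gkDim K B M := by
  refine finite_and_gkDim_le_of_maps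
    (fun k => σ.symm.toLinearMap ∘ₗ Linear.leftComp K Z (u k) ∘ₗ τ.toLinearMap)
    (fun k n => τ.symm (v k ≫ σ n))
    (fun j => σ.symm.toLinearMap ∘ₗ Linear.leftComp K Z (p j) ∘ₗ τ.toLinearMap)
    (fun j n => τ.symm (f j ≫ σ n)) ?_ ?_ ?_ ?_ ?_
  · intro n
    apply σ.injective
    simp only [map_sum, LinearMap.comp_apply, LinearEquiv.coe_coe, Linear.leftComp_apply,
      LinearEquiv.apply_symm_apply, ← Category.assoc]
    rw [← Preadditive.sum_comp, huv, Category.id_comp]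
  · intro m
    apply τ.injective
    simp only [map_sum, LinearMap.comp_apply, LinearEquiv.coe_coe, Linear.leftComp_apply,
      LinearEquiv.apply_symm_apply, ← Category.assoc]
    rw [← Preadditive.sum_comp, hfp, Category.id_comp]
  · refine fun a k l => ⟨θ.symm (v k ≫ ρ a ≫ u l), fun m => τ.injective ?_⟩
    simp [hσ, hτ]
  · refine fun k j => ⟨θ.symm (v k ≫ p j), fun m => τ.injective ?_⟩
    simp [hτ]
  · refine fun b k j => ⟨ρ.symm (u k ≫ θ b ≫ f j), fun n => σ.injective ?_⟩
    simp [hσ, hτ]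

end Category

/-! ### Retracts of separators in module categories -/

section ModuleCat

open CategoryTheory

open scoped ModuleCat.Algebra

variable {R : Type v} [Ring R] {X : ModuleCat.{w} R}

/-- A homomorphism `f` from a module `X` isomorphic to `R` by `ε` corresponds to the element
`f (ε 1)` of its target. The target is given up to an isomorphism, which makes
room for a change of universe and for another `K`-module structure. -/
noncomputable def homOfRankOneEquiv (K : Type u) [Field K] [Algebra K R] (ε : R ≃ₗ[R] X)
    {M : Type*} [AddCommGroup M] [Module K M] [Module R M] [IsScalarTower K R M]
    {Z : ModuleCat.{w} R} (g : M ≃ₗ[R] Z) : M ≃ₗ[K] (X ⟶ Z) where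
  toFun m := ModuleCat.ofHom (LinearMap.toSpanSingleton R Z (g m) ∘ₗ ε.symm.toLinearMap)
  invFun f := g.symm (f.hom (ε 1))
  map_add' m m' := by
    ext x
    simp
  map_smul' k m := by
    ext x
    have h1 : g (k • m) = algebraMap K R k • g m := by rw [← algebraMap_smul R k m, map_smul]
    change ε.symm x • g (k • m) = algebraMap K R k • ε.symm x • g m
    rw [h1, ← mul_smul, ← mul_smul, Algebra.commutes]
  left_inv m := by simp
  right_inv f := by
    ext x
    obtain ⟨r, rfl⟩ := ε.surjective x
    simp [← map_smul]

theorem homOfRankOneEquiv_smul {K : Type u} [Field K] [Algebra K R] (ε : R ≃ₗ[R] X)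
    {M : Type*} [AddCommGroup M] [Module K M] [Module R M] [IsScalarTower K R M]
    {Z : ModuleCat.{w} R} (g : M ≃ₗ[R] Z) (a : R) (m : M) :
    homOfRankOneEquiv K ε g (a • m) =
      homOfRankOneEquiv K ε (Z := X) ε a ≫ homOfRankOneEquiv K ε g m := by
  ext x
  obtain ⟨r, rfl⟩ := ε.surjective x
  simp [homOfRankOneEquiv, mul_smul]

theorem isSeparator_of_linearEquiv (ε : R ≃ₗ[R] X) : IsSeparator X := by
  rw [Preadditive.isSeparator_iff]
  intro M N f hf
  ext m
  have := hf (ModuleCat.ofHom (LinearMap.toSpanSingleton R M m ∘ₗ ε.symm.toLinearMap))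
  simpa using congrArg (fun h => h.hom (ε 1)) this

/-- A module of rank one is a retract of a finite sum of copies of any separator. -/
theorem exists_sum_comp_eq_id_of_isSeparator (ε : R ≃ₗ[R] X) {Y : ModuleCat.{w} R}
    (hY : IsSeparator Y) :
    ∃ (n : ℕ) (u : Fin n → (X ⟶ Y)) (v : Fin n → (Y ⟶ X)),
      ∑ k, u k ≫ v k = 𝟙 X := by
  let T : Submodule R X := Submodule.span R {x | ∃ (v : Y ⟶ X) (y : Y), v.hom y = x}
  -- the quotient map by the trace `T` of `Y` vanishes after composition with each `Y ⟶ X`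
  have hπ : ModuleCat.ofHom T.mkQ = 0 := (Preadditive.isSeparator_iff Y).1 hY _ fun v => by
    ext y
    exact (Submodule.Quotient.mk_eq_zero T).2 (Submodule.subset_span ⟨v, y, rfl⟩)
  have hT : ε 1 ∈ T := by
    rw [← Submodule.Quotient.mk_eq_zero]
    exact congrArg (fun h => h.hom (ε 1)) hπ
  obtain ⟨n, c, g, hg⟩ := Submodule.mem_span_set'.1 hT
  choose v y hvy using fun i => (g i).2
  refine ⟨n, fun i => ModuleCat.ofHom (LinearMap.toSpanSingleton R Y (c i • y i) ∘ₗ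
    ε.symm.toLinearMap), v, ?_⟩
  ext x
  obtain ⟨r, rfl⟩ := ε.surjective x
  have : ε r = r • ε 1 := by rw [← map_smul, smul_eq_mul, mul_one]
  simp only [ModuleCat.hom_sum, ModuleCat.hom_comp, ModuleCat.hom_ofHom, ModuleCat.hom_id,
    LinearMap.sum_apply, LinearMap.comp_apply, LinearEquiv.coe_coe, LinearEquiv.symm_apply_apply,
    LinearMap.toSpanSingleton_apply, map_smul, hvy, LinearMap.id_apply]
  rw [← Finset.smul_sum, hg, this]

end ModuleCat

/-! ### Morita equivalence -/

section Morita

open CategoryTheory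

open scoped ModuleCat.Algebra

variable {K : Type u} [Field K] {A : Type v} [Ring A] [Algebra K A] {B : Type w} [Ring B]
  [Algebra K B]

/-- The `A`-module which corresponds to `B` under a Morita equivalence is a progenerator. -/
theorem exists_sum_comp_eq_id_of_moritaEquivalence (e : MoritaEquivalence K A B)
    {X : ModuleCat.{max v w} A} (εA : A ≃ₗ[A] X) {Y : ModuleCat.{max v w} B} (εB : B ≃ₗ[B] Y) :
    ∃ (m n : ℕ) (u : Fin m → (X ⟶ e.eqv.inverse.obj Y)) (v : Fin m → (e.eqv.inverse.obj Y ⟶ X))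
      (f : Fin n → (e.eqv.inverse.obj Y ⟶ X)) (p : Fin n → (X ⟶ e.eqv.inverse.obj Y)),
      ∑ k, u k ≫ v k = 𝟙 X ∧ ∑ j, f j ≫ p j = 𝟙 (e.eqv.inverse.obj Y) := by
  obtain ⟨m, u, v, huv⟩ := exists_sum_comp_eq_id_of_isSeparator εA
    ((isSeparator_of_linearEquiv εB).of_equivalence e.eqv.symm)
  obtain ⟨n, f, p, hfp⟩ := exists_sum_comp_eq_id_of_isSeparator εB
    ((isSeparator_of_linearEquiv εA).of_equivalence e.eqv)
  let η := e.eqv.unitIso.app X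
  have : e.eqv.inverse.Additive := e.symm.eqv.functor.additive_of_preserves_binary_products
  refine ⟨m, n, u, v, fun j => e.eqv.inverse.map (f j) ≫ η.inv,
    fun j => η.hom ≫ e.eqv.inverse.map (p j), huv, ?_⟩
  have h := congrArg e.eqv.inverse.map hfp
  rw [CategoryTheory.Functor.map_sum, CategoryTheory.Functor.map_id] at h
  rw [← h]
  refine Finset.sum_congr rfl fun j _ => ?_
  rw [Category.assoc, Iso.inv_hom_id_assoc, CategoryTheory.Functor.map_comp]

/-- A Morita equivalence preserves finite generation, and it takes a nonzero finitely generated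
`B`-module to an `A`-module of the same kind whose Gelfand-Kirillov dimension is not larger. -/
theorem finiteType_and_holonomicNumber_le_gkDim_of_isMoritaEquivalent [Algebra.FiniteType K A]
    (h : IsMoritaEquivalent K A B) :
    Algebra.FiniteType K B ∧
    (∀ (M : Type*) [AddCommGroup M] [Module K M] [Module B M] [IsScalarTower K B M]
      [Module.Finite B M] [Nontrivial M],
      holonomicNumber K A ≤ gkDim K B M) := by
  obtain ⟨e⟩ := h.cond
  obtain ⟨X, ⟨εA⟩⟩ : ∃ X : ModuleCat.{max v w} A, Nonempty (A ≃ₗ[A] X) :=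
    ⟨ModuleCat.of A (ULift.{w} A), ⟨ULift.moduleEquiv.symm⟩⟩
  obtain ⟨Y, ⟨εB⟩⟩ : ∃ Y : ModuleCat.{max v w} B, Nonempty (B ≃ₗ[B] Y) :=
    ⟨ModuleCat.of B (ULift.{v} B), ⟨ULift.moduleEquiv.symm⟩⟩
  obtain ⟨m, n, u, v, f, p, huv, hfp⟩ := exists_sum_comp_eq_id_of_moritaEquivalence e εA εB
  let G := e.eqv.inverse
  have : G.Additive := e.symm.eqv.functor.additive_of_preserves_binary_products
  let E : ∀ P Q : ModuleCat.{max v w} B, (P ⟶ Q) ≃ₗ[K] (G.obj P ⟶ G.obj Q) := fun P Q =>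
    LinearEquiv.ofBijective (G.mapLinearMap K) ⟨G.map_injective, G.map_surjective⟩
  have hE : ∀ {P Q S : ModuleCat.{max v w} B} (x : P ⟶ Q) (y : Q ⟶ S),
      E P S (x ≫ y) = E P Q x ≫ E Q S y := fun x y => G.map_comp x y
  let ρ : A ≃ₗ[K] (X ⟶ X) := homOfRankOneEquiv K εA (Z := X) εA
  let θ : B ≃ₗ[K] (G.obj Y ⟶ G.obj Y) := homOfRankOneEquiv K εB (Z := Y) εB ≪≫ₗ E Y Y
  have hρ : ∀ a b, ρ (a * b) = ρ a ≫ ρ b := fun a b => homOfRankOneEquiv_smul εA (Z := X) εA a b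
  have hθ : ∀ a b, θ (a * b) = θ a ≫ θ b := fun a b =>
    (congrArg (E Y Y) (homOfRankOneEquiv_smul εB (Z := Y) εB a b)).trans (hE _ _)
  have hB : Algebra.FiniteType K B := finiteType_of_sum_comp_eq_id ρ hρ θ hθ u v huv f p hfp
  refine ⟨hB, fun M _ _ _ _ _ _ => ?_⟩
  -- `M` is isomorphic to a module in the universe of the module categories
  obtain ⟨r, q, hq⟩ := Module.Finite.exists_fin' B M
  obtain ⟨Z, ⟨g⟩⟩ : ∃ Z : ModuleCat.{max v w} B, Nonempty (M ≃ₗ[B] Z) :=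
    ⟨ModuleCat.of B (ULift.{v} ((Fin r → B) ⧸ LinearMap.ker q)),
      ⟨(q.quotKerEquivOfSurjective hq).symm ≪≫ₗ ULift.moduleEquiv.symm⟩⟩
  let τ : M ≃ₗ[K] (G.obj Y ⟶ G.obj Z) := homOfRankOneEquiv K εB (Z := Z) g ≪≫ₗ E Y Z
  have hτ : ∀ b m, τ (b • m) = θ b ≫ τ m := fun b m =>
    (congrArg (E Y Z) (homOfRankOneEquiv_smul εB (Z := Z) g b m)).trans (hE _ _)
  obtain ⟨hfin, hle⟩ := finite_and_gkDim_le_of_sum_comp_eq_id (N := G.obj Z) ρ θ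
    (homOfRankOneEquiv K εA (LinearEquiv.refl A (G.obj Z)))
    (homOfRankOneEquiv_smul εA (LinearEquiv.refl A (G.obj Z))) τ hτ u v huv f p hfp
  have hnt : Nontrivial (G.obj Z) := by
    by_contra hcon
    rw [not_nontrivial_iff_subsingleton] at hcon
    have : Subsingleton (G.obj Y ⟶ G.obj Z) := ⟨fun x y => by
      ext
      exact Subsingleton.elim _ _⟩
    exact not_subsingleton M τ.toEquiv.subsingleton
  exact (holonomicNumber_le_gkDim (G.obj Z)).trans hle

end Morita

end FilterDim

theorem mainTheorem7 {K : Type*} [Field K] {A : Type*} [Ring A] [Algebra K A]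
    [IsSimpleRing A] [Algebra.FiniteType K A] {B : Type*} [Ring B] [Algebra K B]
    (h : IsMoritaEquivalent K A B) :
    Algebra.FiniteType K B ∧
    (∀ (M : Type*) [AddCommGroup M] [Module K M] [Module B M] [IsScalarTower K B M]
      [Module.Finite B M] [Nontrivial M],
      FilterDim.holonomicNumber K A ≤ FilterDim.gkDim K B M) ∧
    FilterDim.gkDimAlg K A / (FilterDim.fdim K A + max (FilterDim.fdim K A) 1) ≤
      FilterDim.holonomicNumber K A := by
  obtain ⟨hB, hM⟩ :=
    FilterDim.finiteType_and_holonomicNumber_le_gkDim_of_isMoritaEquivalent h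
  refine ⟨hB, hM, ?_⟩
  refine le_iInf fun M => le_iInf fun _ => le_iInf fun _ => le_iInf fun _ => le_iInf fun _ =>
    le_iInf fun _ => le_iInf fun _ => ?_
  exact FilterDim.gkDimAlg_div_le_gkDim
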